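/- Conventions. Let $T$ be a finite tree and $\lambda\in\mathbb R$ an eigenvalue of its adjacency matrix; eigenvectors are real and non-zero. For a finite graph $G$ and $\mu\in\mathbb R$ let $N_\mu(G)$ be the set of vertices on which every eigenvector of $G$ for $\mu$ vanishes, and let $N^C_\mu(G)$ be the set of vertices $v$ for which there is an eigenvector $x$ of $G$ for $\mu$ with $x(v)=0$ and $x(u)\neq 0$ for some neighbour $u$ of $v$ (for trees $N^C_\mu(G)\subseteq N_\mu(G)$). Let $C_1,\dots,C_s$ be the components of $T\setminus N_\lambda(T)$ and let $c_1,\dots,c_s$ be the vertices to which they are contracted in $T/\{C_i\}_{i=1}^s$. The skeleton $S_\lambda(T)$ is the subgraph of $T/\{C_i\}_{i=1}^s$ induced by $N^C_\lambda(T)\cup\{c_1,\dots,c_s\}$; its null space is the null space of its adjacency matrix, and its nullity is the dimension of that space. A set $\{x_1,\dots,x_r\}$ of eigenvectors of a graph $G$ for $\mu$ is straight if the components of $G\setminus N_\mu(G)$ can be numbered $D_1,\dots,D_m$ (with $m\ge r$) so that $x_j|_{D_j}\neq 0$ and $x_j|_{D_i}=0$ for $1\le j\le r$ and $j<i\le r$.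 Say that a vector $b$ on $V(T)$ and a vector $b'$ on $V(S_\lambda(T))$ match if $b$ vanishes on $N_\lambda(T)$, $b'$ vanishes on $N^C_\lambda(T)$, and for each $i$ either $b'(c_i)\neq0$ and $b$ has no zero entry on $C_i$, or $b'(c_i)=0$ and $b|_{C_i}=0$. Theorem. (1) For every eigenvector $b$ of $T$ for $\lambda$ there is a non-zero vector $b'$ in the null space of $S_\lambda(T)$ that matches $b$. (2) If $\{b_1,\dots,b_r\}$ is a straight set of eigenvectors of $T$ for $\lambda$ and $b'_1,\dots,b'_r$ are non-zero vectors in the null space of $S_\lambda(T)$ such that $b'_j$ matches $b_j$ for every $j$, then $b'_1,\dots,b'_r$ are linearly independent. (3) For every non-zero vector $b'$ in the null space of $S_\lambda(T)$ there is an eigenvector $b$ of $T$ for $\lambda$ that matches $b'$. (4) If $\{b'_1,\dots,b'_r\}$ is a straight set of eigenvectors of $S_\lambda(T)$ for the eigenvalue $0$ and $b_1,\dots,b_r$ are eigenvectors of $T$ for $\lambda$ such that $b_j$ matches $b'_j$ for every $j$, then $b_1,\dots,b_r$ are linearly independent. (5) The multiplicity of $\lambda$ as an eigenvalue of $T$ equals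 the nullity of $S_\lambda(T)$. -/

import Mathlib

namespace TreeSkeleton

/-- The adjacency matrix of a finite graph, acting on real vectors indexed by its vertices. -/
noncomputable def adjOp {V : Type*} [Finite V] (G : SimpleGraph V) : Module.End ℝ (V → ℝ) :=
  letI : Fintype V := Fintype.ofFinite V
  letI : DecidableEq V := Classical.decEq V
  letI : DecidableRel G.Adj := Classical.decRel G.Adj
  Matrix.toLin' (G.adjMatrix ℝ)

/-- `x` is an eigenvector (in particular non-zero) of the graph `G` for the eigenvalue `lam`. -/
def IsEigvec {V : Type*} [Finite V] (G : SimpleGraph V) (lam : ℝ) (x : V → ℝ) : Prop :=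
  (adjOp G).HasEigenvector lam x

/-- `N_lam(G)`: the vertices on which every eigenvector for `lam` vanishes. -/
def zeroSet {V : Type*} [Finite V] (G : SimpleGraph V) (lam : ℝ) : Set V :=
  {v | ∀ x : V → ℝ, IsEigvec G lam x → x v = 0}

/-- `N^C(G, x)`: the vertices on which `x` vanishes and that are adjacent to a vertex on which
`x` does not vanish, i.e. to one of the components of the graph `G` minus the zeros of `x`. -/
def zeroBdryOf {V : Type*} (G : SimpleGraph V) (x : V → ℝ) : Set V :=
  {v | x v = 0 ∧ ∃ u, G.Adj v u ∧ x u ≠ 0}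

/-- `N^C_lam(G)`: the union of the sets `N^C(G, x)` over all eigenvectors `x` for `lam`. -/
def zeroBdry {V : Type*} [Finite V] (G : SimpleGraph V) (lam : ℝ) : Set V :=
  {v | ∃ x : V → ℝ, IsEigvec G lam x ∧ v ∈ zeroBdryOf G x}

/-- The components of `G` minus the vertex set `N`. -/
abbrev Comp {V : Type*} (G : SimpleGraph V) (N : Set V) : Type _ :=
  (G.induce Nᶜ).ConnectedComponent

/-- The set of vertices of `G` that lie in the component `C` of `G` minus `N`. -/
def Comp.verts {V : Type*} {G : SimpleGraph V} {N : Set V} (C : Comp G N) : Set V :=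
  Subtype.val '' C.supp

open Classical in
/-- The vertex of the contracted graph to which a vertex of `G` belongs: a vertex of `N` stays
itself, any other vertex goes to the contracted vertex of its component. -/
noncomputable def contractMap {V : Type*} (G : SimpleGraph V) (N : Set V) (v : V) :
    ↥N ⊕ Comp G N :=
  if h : v ∈ N then Sum.inl ⟨v, h⟩ else Sum.inr ((G.induce Nᶜ).connectedComponentMk ⟨v, h⟩)

/-- The graph obtained from `G` by contracting every component of `G` minus `N` to one vertex;
two distinct vertices are adjacent if some edge of `G` joins the corresponding parts. -/
noncomputable def contraction {V : Type*} (G : SimpleGraph V) (N : Set V) :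
    SimpleGraph (↥N ⊕ Comp G N) :=
  G.map (contractMap G N)

/-- The vertices of the contraction by the components of `G` minus `N_lam(G)` that belong to the
skeleton: those of `N^C_lam(G)` and all contracted vertices. -/
def skeletonVerts {V : Type*} [Finite V] (G : SimpleGraph V) (lam : ℝ) :
    Set (↥(zeroSet G lam) ⊕ Comp G (zeroSet G lam)) :=
  {a | (∃ w, w.1 ∈ zeroBdry G lam ∧ a = Sum.inl w) ∨ ∃ C, a = Sum.inr C}

/-- The skeleton `S_lam(G)`. -/
noncomputable def skeleton {V : Type*} [Finite V] (G : SimpleGraph V) (lam : ℝ) :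
    SimpleGraph ↥(skeletonVerts G lam) :=
  (contraction G (zeroSet G lam)).induce (skeletonVerts G lam)

/-- The skeleton vertex obtained by contracting the component `C`. -/
def compVertex {V : Type*} [Finite V] {G : SimpleGraph V} {lam : ℝ}
    (C : Comp G (zeroSet G lam)) : ↥(skeletonVerts G lam) :=
  ⟨Sum.inr C, Or.inr ⟨C, rfl⟩⟩

instance {V : Type*} [Finite V] (G : SimpleGraph V) (N : Set V) : Finite (Comp G N) :=
  Quot.finite _

/-- `x` and `y` have matching zero/non-zero patterns: `x` is non-zero everywhere on a component `C`
of `G` minus `N_lam(G)` if `y` is non-zero on the contracted vertex of `C`, and `x` is zero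
everywhere on `C` otherwise; `x` vanishes on `N_lam(G)` and `y` on all skeleton vertices that are
not contracted components. -/
def SamePattern {V : Type*} [Finite V] (G : SimpleGraph V) (lam : ℝ)
    (x : V → ℝ) (y : ↥(skeletonVerts G lam) → ℝ) : Prop :=
  (∀ C : Comp G (zeroSet G lam), ∀ v ∈ C.verts, x v ≠ 0 ↔ y (compVertex C) ≠ 0) ∧
  (∀ v ∈ zeroSet G lam, x v = 0) ∧
  (∀ a : ↥(skeletonVerts G lam), (∀ C, a ≠ compVertex C) → y a = 0)

/-- The eigenvectors `x 0, ..., x (r - 1)` of `G` for `lam` form a straight set: there are distinct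
components `C 0, ..., C (r - 1)` of `G` minus `N_lam(G)` (the first `r` in a numbering of all
components) such that `x j` does not vanish identically on `C j` but does so on `C i` for
`j < i`. -/
def IsStraight {V : Type*} [Finite V] (G : SimpleGraph V) (lam : ℝ) {r : ℕ}
    (x : Fin r → V → ℝ) : Prop :=
  (∀ j, IsEigvec G lam (x j)) ∧
  ∃ C : Fin r ↪ Comp G (zeroSet G lam),
    ∀ j, (∃ v ∈ (C j).verts, x j v ≠ 0) ∧ ∀ i, j < i → ∀ v ∈ (C i).verts, x j v = 0

/-- The multiplicity of the eigenvalue `lam` of `G`, i.e. the dimension of its eigenspace. -/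
noncomputable def multiplicity {V : Type*} [Finite V] (G : SimpleGraph V) (lam : ℝ) : ℕ :=
  Module.finrank ℝ ((adjOp G).eigenspace lam)

/-- The nullity of `G`, i.e. the dimension of the null space of its adjacency matrix. -/
noncomputable def nullity {V : Type*} [Finite V] (G : SimpleGraph V) : ℕ :=
  Module.finrank ℝ (LinearMap.ker (adjOp G))

end TreeSkeleton

/-!
On a forest an antisymmetric function on the arcs with zero divergence vanishes, because every edge
is a bridge. For eigenvectors `x`, `y` of the same eigenvalue, `x a * y b - x b * y a` is such a
function, so `x` and `y` are proportional along every edge. Hence, on each component of the forest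
minus `N_lam`, all eigenvectors are multiples of one generic eigenvector `z`.

Since a forest has no cycles, there is a nowhere zero `θ` such that `θ * z` is constant on these
components and `θ` does not change along the edges at `N_lam`. Multiplication by `θ` makes all
eigenvectors constant on the components and keeps the sums over the neighbours of a vertex of
`N_lam` equal to zero. The vectors obtained in this way are exactly the pullbacks of the null
vectors of the skeleton.
-/

namespace TreeSkeleton

open SimpleGraph

section Algebra

theorem linearIndependent_of_triangular {R ι κ : Type*} [CommRing R] [IsDomain R] [Finite ι]
    [LinearOrder ι] {x : ι → κ → R} (w : ι → κ) (hdiag : ∀ j, x j (w j) ≠ 0)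
    (hupper : ∀ j i, j < i → x j (w i) = 0) : LinearIndependent R x := by
  let M : Matrix ι ι R := Matrix.of fun j i => x j (w i)
  have := Fintype.ofFinite ι
  have hM : M.det ≠ 0 := by
    rw [M.det_of_isLowerTriangular fun j i h => hupper j i h]
    exact Finset.prod_ne_zero_iff.2 fun j _ => hdiag j
  exact .of_comp (LinearMap.funLeft R R w) (Matrix.linearIndependent_rows_of_det_ne_zero hM)

theorem exists_linearEquiv_of_map_eq {R M M' P : Type*} [Ring R] [AddCommGroup M]
    [AddCommGroup M'] [AddCommGroup P] [Module R M] [Module R M'] [Module R P]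
    {f : M →ₗ[R] P} {g : M' →ₗ[R] P} (hf : Function.Injective f) (hg : Function.Injective g)
    {p : Submodule R M} {q : Submodule R M'} (h : p.map f = q.map g) :
    ∃ Φ : p ≃ₗ[R] q, ∀ x, g (Φ x) = f x := by
  let e := (p.equivMapOfInjective f hf).trans (LinearEquiv.ofEq _ _ h)
  let e' := q.equivMapOfInjective g hg
  exact ⟨e.trans e'.symm, fun x => congrArg Subtype.val (e'.apply_symm_apply (e x))⟩

end Algebra

section Acyclic

variable {V W : Type*} {G : SimpleGraph V}

/-- `S` is a side of the bridge `uv`: it contains `u` but not `v`, and `uv` is the only edge that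
leaves it. -/
structure IsBridgeSide (G : SimpleGraph V) (S : Set V) (u v : V) : Prop where
  left_mem : u ∈ S
  right_notMem : v ∉ S
  eq_of_adj : ∀ a ∈ S, ∀ b ∉ S, G.Adj a b → a = u ∧ b = v

theorem isBridge_iff_exists_isBridgeSide {u v : V} :
    G.IsBridge s(u, v) ↔ ∃ S, IsBridgeSide G S u v := by
  rw [isBridge_iff]
  constructor
  · refine fun hbridge => ⟨{a | (G.deleteEdges {s(u, v)}).Reachable u a}, .refl u, hbridge, ?_⟩
    intro a ha b hb hab
    have hdel : ¬ (G.deleteEdges {s(u, v)}).Adj a b := fun h => hb (ha.trans h.reachable)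
    have hedge : s(a, b) = s(u, v) := by
      by_contra h
      exact hdel (deleteEdges_adj.2 ⟨hab, h⟩)
    obtain h | ⟨-, rfl⟩ := Sym2.eq_iff.1 hedge
    exacts [h, (hb (.refl _)).elim]
  · rintro ⟨S, hS⟩ ⟨p⟩
    obtain ⟨d, -, hfst, hsnd⟩ := p.exists_boundary_dart S hS.left_mem hS.right_notMem
    have hadj := deleteEdges_adj.1 d.adj
    obtain ⟨hu, hv⟩ := hS.eq_of_adj _ hfst _ hsnd hadj.1
    exact hadj.2 (by rw [hu, hv]; rfl)

theorem isAcyclic_iff_forall_adj_exists_isBridgeSide :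
    G.IsAcyclic ↔ ∀ ⦃u v⦄, G.Adj u v → ∃ S, IsBridgeSide G S u v := by
  simp only [isAcyclic_iff_forall_adj_isBridge, isBridge_iff_exists_isBridgeSide]

theorem circulation_eq_zero [Finite V] {A : Type*} [AddCommGroup A] (hG : G.IsAcyclic)
    {g : V → V → A} (hanti : ∀ a b, g b a = -g a b)
    (hdiv : ∀ a, ∑ᶠ b ∈ G.neighborSet a, g a b = 0) {u v : V} (huv : G.Adj u v) : g u v = 0 := by
  classical
  have := Fintype.ofFinite V
  obtain ⟨S, hS⟩ := isAcyclic_iff_forall_adj_exists_isBridgeSide.1 hG huv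
  -- Sum `g` over all arcs that start in `S`: the arcs inside `S` cancel in pairs, and `uv` is the
  -- only other one.
  let D : Finset (V × V) := {p | p.1 ∈ S ∧ G.Adj p.1 p.2}
  have htotal : ∑ p ∈ D, g p.1 p.2 = 0 := by
    have hdiv' : ∀ a, ∑ b with G.Adj a b, g a b = 0 := fun a => by
      simpa [← finsum_mem_coe_finset] using hdiv a
    simp only [D, Finset.sum_filter, Fintype.sum_prod_type, ite_and] at hdiv' ⊢
    exact Finset.sum_eq_zero fun a _ => by split_ifs <;> simp [hdiv' a]
  have hinner : ∑ p ∈ D with p.2 ∈ S, g p.1 p.2 = 0 := by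
    refine Finset.sum_involution (fun p _ => p.swap) (fun p _ => ?_) (fun p hp _ h => ?_)
      (fun p hp => ?_) (fun p _ => p.swap_swap)
    · simp [hanti p.1 p.2]
    · simp only [D, Finset.mem_filter] at hp
      exact hp.1.2.2.ne (congrArg Prod.snd h)
    · simp only [D, Finset.mem_filter, Finset.mem_univ, true_and, Prod.fst_swap,
        Prod.snd_swap] at hp ⊢
      exact ⟨⟨hp.2, hp.1.2.symm⟩, hp.1.1⟩
  have houter : (D.filter fun p => p.2 ∉ S) = {(u, v)} := by
    ext ⟨a, b⟩
    simp only [D, Finset.mem_filter, Finset.mem_univ, true_and, Finset.mem_singleton,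
      Prod.mk.injEq]
    constructor
    · exact fun ⟨⟨ha, hab⟩, hb⟩ => hS.eq_of_adj a ha b hb hab
    · rintro ⟨rfl, rfl⟩
      exact ⟨⟨hS.left_mem, huv⟩, hS.right_notMem⟩
  simpa [htotal, hinner, houter] using Finset.sum_filter_add_sum_filter_not D (·.2 ∈ S)
    fun p => g p.1 p.2

theorem exists_potential {A : Type*} [Group A] (hG : G.IsAcyclic) (ρ : V → V → A)
    (hρ : ∀ a b, ρ b a = (ρ a b)⁻¹) : ∃ θ : V → A, ∀ a b, G.Adj a b → θ b = θ a * ρ a b := by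
  let weight {r v : V} (p : G.Walk r v) : A := (p.darts.map fun d => ρ d.fst d.snd).prod
  have weight_concat {r a b : V} (p : G.Walk r a) (hab : G.Adj a b) :
      weight (p.concat hab) = weight p * ρ a b := by
    simp [weight, Walk.darts_concat]
  have weight_eq {r a b : V} {p : G.Walk r a} {q : G.Walk r b} (hp : p.IsPath) (hq : q.IsPath)
      (hab : G.Adj a b) : weight q = weight p * ρ a b := by
    by_cases ha : a ∈ q.support
    · rw [hG.path_concat hp hq hab ha, weight_concat]
    · have hb := hG.mem_support_of_ne_mem_support_of_adj_of_isPath hp hq hab ha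
      rw [hG.path_concat hq hp hab.symm hb, weight_concat, hρ a b, inv_mul_cancel_right]
  let root (v : V) : V := (G.connectedComponentMk v).out
  have exists_path (v : V) : ∃ p : G.Walk (root v) v, p.IsPath :=
    (ConnectedComponent.exact (Quot.out_eq (G.connectedComponentMk v))).exists_isPath
  choose path isPath_path using exists_path
  refine ⟨fun v => weight (path v), fun a b hab => ?_⟩
  have hroot : root a = root b :=
    congrArg Quot.out (ConnectedComponent.sound hab.reachable)
  obtain ⟨p, hp, hpa⟩ : ∃ p : G.Walk (root b) a, p.IsPath ∧ weight p = weight (path a) :=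
    hroot ▸ ⟨path a, isPath_path a, rfl⟩
  exact (weight_eq hp (isPath_path b) hab).trans (congrArg (· * ρ a b) hpa)

theorem mem_of_preconnected_fibre {f : V → W} {S : Set V} {p q : V}
    (hfibre : (G.induce (f ⁻¹' {f q})).Preconnected)
    (hS : ∀ a ∈ S, ∀ b ∉ S, G.Adj a b → f a ≠ f b) (hpq : f p = f q) (hp : p ∈ S) : q ∈ S := by
  by_contra hq
  obtain ⟨walk⟩ := hfibre ⟨p, hpq⟩ ⟨q, rfl⟩
  obtain ⟨d, -, hfst, hsnd⟩ := walk.exists_boundary_dart (Subtype.val ⁻¹' S) hp hq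
  exact hS _ hfst _ hsnd d.adj (d.fst.2.trans d.snd.2.symm)

theorem IsBridgeSide.mem_of_apply_eq {f : V → W} {S : Set V} {u v p q : V}
    (hS : IsBridgeSide G S u v) (huv : f u ≠ f v)
    (hfibre : (G.induce (f ⁻¹' {f q})).Preconnected) (hpq : f p = f q) (hp : p ∈ S) : q ∈ S := by
  refine mem_of_preconnected_fibre hfibre (fun a ha b hb hab => ?_) hpq hp
  obtain ⟨rfl, rfl⟩ := hS.eq_of_adj a ha b hb hab
  exact huv

theorem isAcyclic_map (hG : G.IsAcyclic) {f : V → W}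
    (hfibre : ∀ w, (G.induce (f ⁻¹' {w})).Preconnected) : (G.map f).IsAcyclic := by
  rw [isAcyclic_iff_forall_adj_exists_isBridgeSide]
  intro x y hxy
  obtain ⟨hne, u, v, huv, rfl, rfl⟩ := (map_adj' ..).1 hxy
  obtain ⟨S, hS⟩ := isAcyclic_iff_forall_adj_exists_isBridgeSide.1 hG huv
  have hsat {p q : V} : f p = f q → p ∈ S → q ∈ S := hS.mem_of_apply_eq hne (hfibre _)
  refine ⟨f '' S, ⟨u, hS.left_mem, rfl⟩, fun ⟨p, hp, hpv⟩ => hS.right_notMem (hsat hpv hp), ?_⟩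
  rintro _ ⟨p, hp, rfl⟩ _ hc hadj
  obtain ⟨-, a, b, hab, hap, rfl⟩ := (map_adj' ..).1 hadj
  obtain ⟨rfl, rfl⟩ := hS.eq_of_adj a (hsat hap.symm hp) b (fun hb => hc ⟨b, hb, rfl⟩) hab
  exact ⟨hap.symm, rfl⟩

theorem eq_of_adj_of_preconnected_fibre (hG : G.IsAcyclic) {f : V → W} {u u' v : V}
    (hfibre : (G.induce (f ⁻¹' {f u'})).Preconnected) (huv : G.Adj u v) (huv' : G.Adj u' v)
    (huu' : f u = f u') (hne : f u ≠ f v) : u = u' := by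
  obtain ⟨S, hS⟩ := isAcyclic_iff_forall_adj_exists_isBridgeSide.1 hG huv
  have hu' : u' ∈ S := hS.mem_of_apply_eq hne hfibre huu' hS.left_mem
  exact (hS.eq_of_adj u' hu' v hS.right_notMem huv').1.symm

end Acyclic

section Eigenvectors

variable {V W : Type*} [Finite V] {G : SimpleGraph V} {lam : ℝ}

theorem adjOp_apply (x : V → ℝ) (v : V) : adjOp G x v = ∑ᶠ u ∈ G.neighborSet v, x u := by
  classical
  have := Fintype.ofFinite V
  rw [finsum_mem_eq_toFinset_sum]
  simp only [adjOp, Matrix.toLin'_apply, Matrix.mulVec, dotProduct, adjMatrix_apply, ite_mul,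
    one_mul, zero_mul, ← Finset.sum_filter]
  refine Finset.sum_congr (Finset.ext fun u => ?_) fun _ _ => rfl
  simp

theorem adjOp_apply_eq_mul {x y : V → ℝ} {v : V} {c : ℝ}
    (h : ∀ u, G.Adj v u → x u = c * y u) : adjOp G x v = c * adjOp G y v := by
  rw [adjOp_apply, adjOp_apply, mul_finsum_mem]
  exact finsum_mem_congr rfl h

theorem adjOp_apply_of_mem_eigenspace {x : V → ℝ} (hx : x ∈ (adjOp G).eigenspace lam) (v : V) :
    adjOp G x v = lam * x v :=
  congrFun (Module.End.mem_eigenspace_iff.1 hx) v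

theorem adjOp_map [Finite W] {f : V → W} (hG : G.IsAcyclic)
    (hfibre : ∀ w, (G.induce (f ⁻¹' {w})).Preconnected) {v : V} (hv : ∀ u, f u = f v → u = v)
    (y : W → ℝ) : adjOp (G.map f) y (f v) = adjOp G (y ∘ f) v := by
  have f_ne {u : V} (hu : G.Adj v u) : f u ≠ f v := fun h => hu.ne (hv u h).symm
  have hbij : Set.BijOn f (G.neighborSet v) ((G.map f).neighborSet (f v)) := by
    refine ⟨fun u hu => (map_adj' ..).2 ⟨(f_ne hu).symm, v, u, hu, rfl, rfl⟩,
      fun u hu u' hu' h => ?_, fun w hw => ?_⟩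
    · exact eq_of_adj_of_preconnected_fibre hG (hfibre _) hu.symm hu'.symm h (f_ne hu)
    · obtain ⟨-, a, u, hau, ha, rfl⟩ := (map_adj' ..).1 hw
      exact ⟨u, hv a ha ▸ hau, rfl⟩
  rw [adjOp_apply, adjOp_apply]
  exact (finsum_mem_eq_of_bijOn f hbij fun _ _ => rfl).symm

theorem adjOp_induce {S : Set V} (y : S → ℝ) (a : S) :
    adjOp (G.induce S) y a = adjOp G (Function.extend Subtype.val y 0) a := by
  have hval := Subtype.val_injective (p := (· ∈ S))
  calc adjOp (G.induce S) y a
      = ∑ᶠ b ∈ (G.induce S).neighborSet a, Function.extend Subtype.val y 0 b.1 := by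
        simp only [adjOp_apply, hval.extend_apply]
    _ = ∑ᶠ b ∈ Subtype.val '' (G.induce S).neighborSet a, Function.extend Subtype.val y 0 b :=
        (finsum_mem_image hval.injOn).symm
    _ = adjOp G (Function.extend Subtype.val y 0) a := by
        rw [adjOp_apply]
        refine finsum_mem_inter_support_eq' _ _ _ fun b hb => ?_
        have hbS : b ∈ S := by
          by_contra h
          exact hb (Function.extend_apply' y (0 : V → ℝ) b fun ⟨b', hb'⟩ => h (hb' ▸ b'.2))
        exact ⟨fun ⟨_, hab', hb'⟩ => hb' ▸ hab', fun hab => ⟨⟨b, hbS⟩, hab, rfl⟩⟩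

theorem mul_eq_mul_of_adj (hG : G.IsAcyclic) {x y : V → ℝ} (hx : x ∈ (adjOp G).eigenspace lam)
    (hy : y ∈ (adjOp G).eigenspace lam) {u v : V} (huv : G.Adj u v) : x u * y v = x v * y u := by
  refine sub_eq_zero.1 (circulation_eq_zero hG (g := fun a b => x a * y b - x b * y a)
    (fun a b => by ring) (fun a => ?_) huv)
  calc ∑ᶠ b ∈ G.neighborSet a, (x a * y b - x b * y a)
      = x a * adjOp G y a - adjOp G x a * y a := by
        rw [finsum_mem_sub_distrib _ _ (Set.toFinite _), ← mul_finsum_mem,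
          ← finsum_mem_mul, adjOp_apply, adjOp_apply]
    _ = 0 := by
        rw [adjOp_apply_of_mem_eigenspace hx, adjOp_apply_of_mem_eigenspace hy]
        ring

theorem nullity_eq_multiplicity_zero : nullity G = multiplicity G 0 := by
  rw [nullity, multiplicity, Module.End.eigenspace_zero]

theorem notMem_zeroSet_iff {v : V} : v ∉ zeroSet G lam ↔ ∃ x, IsEigvec G lam x ∧ x v ≠ 0 := by
  simp [zeroSet]

theorem eq_zero_of_mem_zeroSet {x : V → ℝ} (hx : x ∈ (adjOp G).eigenspace lam) {v : V}
    (hv : v ∈ zeroSet G lam) : x v = 0 := by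
  by_cases h : x = 0
  · rw [h, Pi.zero_apply]
  · exact hv x ⟨hx, h⟩

theorem zeroBdry_subset_zeroSet (hG : G.IsAcyclic) : zeroBdry G lam ⊆ zeroSet G lam := by
  rintro v ⟨x, hx, hxv, u, hvu, hxu⟩ y hy
  have h := mul_eq_mul_of_adj hG hx.1 hy.1 hvu
  rw [hxv, zero_mul, eq_comm, mul_eq_zero] at h
  exact h.resolve_left hxu

theorem mem_zeroBdry_of_adj {v u : V} (hv : v ∈ zeroSet G lam) (hu : u ∉ zeroSet G lam)
    (hvu : G.Adj v u) : v ∈ zeroBdry G lam := by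
  obtain ⟨x, hx, hxu⟩ := notMem_zeroSet_iff.1 hu
  exact ⟨x, hx, hv x hx, u, hvu, hxu⟩

theorem exists_adj_notMem_zeroSet {v : V} (hv : v ∈ zeroBdry G lam) :
    ∃ u, G.Adj v u ∧ u ∉ zeroSet G lam := by
  obtain ⟨x, hx, -, u, hvu, hxu⟩ := hv
  exact ⟨u, hvu, fun hu => hxu (hu x hx)⟩

/-- `z` is a generic vector of the eigenspace of `G` for `lam`: it vanishes only where every
eigenvector does. -/
structure IsGeneric (G : SimpleGraph V) (lam : ℝ) (z : V → ℝ) : Prop where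
  mem_eigenspace : z ∈ (adjOp G).eigenspace lam
  ne_zero : ∀ v ∉ zeroSet G lam, z v ≠ 0

theorem exists_isGeneric (G : SimpleGraph V) (lam : ℝ) : ∃ z, IsGeneric G lam z := by
  obtain ⟨z, hz, hne⟩ := Module.Dual.exists_forall_mem_ne_zero_of_forall_exists
    ((adjOp G).eigenspace lam) (fun v : ↥(zeroSet G lam)ᶜ => LinearMap.proj v.1) fun ⟨v, hv⟩ => by
      obtain ⟨x, hx, hxv⟩ := notMem_zeroSet_iff.1 hv
      exact ⟨x, hx.1, hxv⟩
  exact ⟨z, hz, fun v hv => hne ⟨v, hv⟩⟩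

end Eigenvectors

section Contraction

variable {V : Type*} {G : SimpleGraph V} {N : Set V}

theorem contractMap_of_mem {v : V} (hv : v ∈ N) : contractMap G N v = Sum.inl ⟨v, hv⟩ := dif_pos hv

theorem contractMap_of_notMem {v : V} (hv : v ∉ N) :
    contractMap G N v = Sum.inr ((G.induce Nᶜ).connectedComponentMk ⟨v, hv⟩) := dif_neg hv

theorem contractMap_eq_inl_iff {v : V} {w : N} : contractMap G N v = Sum.inl w ↔ v = w := by
  constructor
  · intro h
    by_cases hv : v ∈ N
    · exact congrArg Subtype.val (Sum.inl_injective ((contractMap_of_mem hv).symm.trans h))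
    · simp [contractMap_of_notMem hv] at h
  · rintro rfl
    exact contractMap_of_mem w.2

theorem mem_verts_iff {C : Comp G N} {v : V} :
    v ∈ C.verts ↔ contractMap G N v = Sum.inr C := by
  constructor
  · rintro ⟨v, hv, rfl⟩
    exact (contractMap_of_notMem v.2).trans (congrArg Sum.inr hv)
  · intro h
    by_cases hv : v ∈ N
    · simp [contractMap_of_mem hv] at h
    · exact ⟨⟨v, hv⟩, Sum.inr_injective ((contractMap_of_notMem hv).symm.trans h), rfl⟩

theorem contractMap_surjective (G : SimpleGraph V) (N : Set V) :
    Function.Surjective (contractMap G N) := by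
  rintro (w | C)
  · exact ⟨w, contractMap_of_mem w.2⟩
  · obtain ⟨v, rfl⟩ := C.exists_rep
    exact ⟨v, contractMap_of_notMem v.2⟩

theorem contractMap_eq_iff_of_adj {a b : V} (hab : G.Adj a b) :
    contractMap G N a = contractMap G N b ↔ a ∉ N ∧ b ∉ N := by
  constructor
  · refine fun h => ⟨fun ha => ?_, fun hb => ?_⟩
    · exact hab.ne' (contractMap_eq_inl_iff.1 (h.symm.trans (contractMap_of_mem ha)))
    · exact hab.ne (contractMap_eq_inl_iff.1 (h.trans (contractMap_of_mem hb)))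
  · rintro ⟨ha, hb⟩
    rw [contractMap_of_notMem ha, contractMap_of_notMem hb]
    exact congrArg Sum.inr (ConnectedComponent.sound (Adj.reachable (induce_adj.2 hab)))

theorem mem_of_contraction_adj {u v : V} (hu : u ∉ N)
    (huv : (contraction G N).Adj (contractMap G N u) (contractMap G N v)) : v ∈ N := by
  by_contra hv
  obtain ⟨hne, u', v', huv', hu', hv'⟩ := (map_adj' ..).1 huv
  have notMem_of_eq {a b : V} (ha : a ∉ N) (hab : contractMap G N b = contractMap G N a) :
      b ∉ N := fun hb =>
    ha (contractMap_eq_inl_iff.1 (hab.symm.trans (contractMap_of_mem hb)) ▸ hb)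
  have heq := (contractMap_eq_iff_of_adj huv').2 ⟨notMem_of_eq hu hu', notMem_of_eq hv hv'⟩
  exact hne (hu'.symm.trans (heq.trans hv'))

theorem preconnected_contractMap_fibre (w : ↥N ⊕ Comp G N) :
    (G.induce (contractMap G N ⁻¹' {w})).Preconnected := by
  rcases w with w | C
  · rintro ⟨a, ha⟩ ⟨b, hb⟩
    obtain rfl : a = b :=
      (contractMap_eq_inl_iff.1 ha).trans (contractMap_eq_inl_iff.1 hb).symm
    exact .refl _
  · let e : C.toSimpleGraph →g G.induce (contractMap G N ⁻¹' {Sum.inr C}) :=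
      { toFun := fun v => ⟨v.1.1, mem_verts_iff.1 ⟨v.1, v.2, rfl⟩⟩
        map_rel' := id }
    have e_surjective : Function.Surjective e := by
      rintro ⟨_, hv⟩
      obtain ⟨v, hvC, rfl⟩ := mem_verts_iff.2 hv
      exact ⟨⟨v, hvC⟩, rfl⟩
    exact C.connected_toSimpleGraph.preconnected.map e e_surjective

theorem eq_of_contractMap_eq {α : Type*} {g : V → α}
    (hg : ∀ a ∉ N, ∀ b ∉ N, G.Adj a b → g a = g b) {p q : V}
    (hpq : contractMap G N p = contractMap G N q) : g p = g q := by
  refine Eq.symm (mem_of_preconnected_fibre (S := {a | g a = g p})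
    (preconnected_contractMap_fibre _) (fun a ha b hb hab heq => ?_) hpq rfl)
  obtain ⟨haN, hbN⟩ := (contractMap_eq_iff_of_adj hab).1 heq
  exact hb ((hg a haN b hbN hab).symm.trans ha)

theorem isAcyclic_contraction (hG : G.IsAcyclic) (N : Set V) : (contraction G N).IsAcyclic :=
  isAcyclic_map hG preconnected_contractMap_fibre

/-- `θ` turns `z` into a vector that is constant on the components of `G` minus `N`, without
changing, up to a common factor, the entries of a vector at the neighbours of a vertex of `N`. -/
structure IsFlattening (G : SimpleGraph V) (N : Set V) (z θ : V → ℝ) : Prop where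
  ne_zero : ∀ v, θ v ≠ 0
  eq_of_adj : ∀ v ∈ N, ∀ u, G.Adj v u → θ u = θ v
  mul_eq_mul_of_adj : ∀ a ∉ N, ∀ b ∉ N, G.Adj a b → θ a * z a = θ b * z b

theorem exists_isFlattening (hG : G.IsAcyclic) {z : V → ℝ} (hz : ∀ v ∉ N, z v ≠ 0) :
    ∃ θ, IsFlattening G N z θ := by
  classical
  let ζ (v : V) : ℝˣ := if hv : v ∈ N then 1 else Units.mk0 (z v) (hz v hv)
  let ρ (a b : V) : ℝˣ := if a ∉ N ∧ b ∉ N then ζ a / ζ b else 1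
  have ρ_symm (a b : V) : ρ b a = (ρ a b)⁻¹ := by
    simp only [ρ, and_comm (a := b ∉ N)]
    split_ifs <;> simp
  obtain ⟨θ, hθ⟩ := exists_potential hG ρ ρ_symm
  refine ⟨fun v => θ v, fun v => (θ v).ne_zero, fun v hv u hvu => ?_, fun a ha b hb hab => ?_⟩
  · simp [hθ v u hvu, ρ, hv]
  · simp [hθ a b hab, ρ, ζ, ha, hb, mul_assoc, hz b hb]

end Contraction

section Skeleton

variable {V : Type*} [Finite V] {G : SimpleGraph V} {lam : ℝ}

theorem isAcyclic_skeleton (hG : G.IsAcyclic) : (skeleton G lam).IsAcyclic :=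
  (isAcyclic_contraction hG _).induce _

theorem contractMap_mem_skeletonVerts_of_notMem {v : V} (hv : v ∉ zeroSet G lam) :
    contractMap G (zeroSet G lam) v ∈ skeletonVerts G lam :=
  .inr ⟨_, contractMap_of_notMem hv⟩

theorem contractMap_mem_skeletonVerts_iff_of_mem {v : V} (hv : v ∈ zeroSet G lam) :
    contractMap G (zeroSet G lam) v ∈ skeletonVerts G lam ↔ v ∈ zeroBdry G lam := by
  rw [contractMap_of_mem hv]
  constructor
  · rintro (⟨w, hw, h⟩ | ⟨C, h⟩)
    · rwa [← Sum.inl_injective h] at hw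
    · cases h
  · exact fun h => .inl ⟨_, h, rfl⟩

/-- The pullback to `G` of a vector on the skeleton: it is constant on the components of `G` minus
`N_lam(G)`, and zero at the vertices that do not survive in the skeleton. -/
noncomputable def skeletonLift (G : SimpleGraph V) (lam : ℝ) :
    (↥(skeletonVerts G lam) → ℝ) →ₗ[ℝ] V → ℝ :=
  LinearMap.funLeft ℝ ℝ (contractMap G (zeroSet G lam)) ∘ₗ
    Function.ExtendByZero.linearMap ℝ Subtype.val

theorem skeletonLift_apply_of_eq {v : V} {a : ↥(skeletonVerts G lam)}
    (h : contractMap G (zeroSet G lam) v = a.1) (y : ↥(skeletonVerts G lam) → ℝ) :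
    skeletonLift G lam y v = y a :=
  (congrArg _ h).trans (Subtype.val_injective.extend_apply y 0 a)

theorem skeletonLift_apply_of_notMem {v : V}
    (h : contractMap G (zeroSet G lam) v ∉ skeletonVerts G lam) (y : ↥(skeletonVerts G lam) → ℝ) :
    skeletonLift G lam y v = 0 :=
  Function.extend_apply' y _ _ fun ⟨a, ha⟩ => h (ha ▸ a.2)

theorem skeletonLift_injective (G : SimpleGraph V) (lam : ℝ) :
    Function.Injective (skeletonLift G lam) := by
  intro y y' h
  funext a
  obtain ⟨v, hv⟩ := contractMap_surjective G _ a.1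
  rw [← skeletonLift_apply_of_eq hv y, h, skeletonLift_apply_of_eq hv]

theorem adjOp_skeleton_apply (hG : G.IsAcyclic) {v : V} (hv : v ∈ zeroSet G lam)
    {a : ↥(skeletonVerts G lam)} (ha : contractMap G (zeroSet G lam) v = a.1)
    (y : ↥(skeletonVerts G lam) → ℝ) :
    adjOp (skeleton G lam) y a = adjOp G (skeletonLift G lam y) v := by
  have fibre_eq (u : V) (hu : contractMap G (zeroSet G lam) u = contractMap G (zeroSet G lam) v) :
      u = v :=
    contractMap_eq_inl_iff.1 (hu.trans (contractMap_of_mem hv))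
  calc adjOp (skeleton G lam) y a
      = adjOp (contraction G (zeroSet G lam)) (Function.extend Subtype.val y 0) a.1 :=
        adjOp_induce y a
    _ = adjOp G (skeletonLift G lam y) v := by
        rw [← ha]
        exact adjOp_map hG preconnected_contractMap_fibre fibre_eq _

theorem samePattern_iff {x : V → ℝ} {y : ↥(skeletonVerts G lam) → ℝ} :
    SamePattern G lam x y ↔
      (∀ v ∈ zeroSet G lam, x v = 0) ∧ ∀ v, x v = 0 ↔ skeletonLift G lam y v = 0 := by
  constructor
  · rintro ⟨hcomp, hzero, hy⟩
    refine ⟨hzero, fun v => ?_⟩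
    by_cases hv : v ∈ zeroSet G lam
    · refine iff_of_true (hzero v hv) ?_
      by_cases hmem : contractMap G (zeroSet G lam) v ∈ skeletonVerts G lam
      · rw [skeletonLift_apply_of_eq (a := ⟨_, hmem⟩) rfl]
        refine hy _ fun C hC => ?_
        cases (contractMap_of_mem hv).symm.trans (congrArg Subtype.val hC)
      · exact skeletonLift_apply_of_notMem hmem y
    · have hC := contractMap_of_notMem (G := G) hv
      rw [skeletonLift_apply_of_eq (a := compVertex _) hC]
      exact not_iff_not.1 (hcomp _ v (mem_verts_iff.2 hC))
  · rintro ⟨hzero, hlift⟩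
    refine ⟨fun C v hv => ?_, hzero, ?_⟩
    · rw [Ne, hlift, skeletonLift_apply_of_eq (a := compVertex C) (mem_verts_iff.1 hv)]
    · intro a ha
      obtain ⟨v, hv⟩ := contractMap_surjective G _ a.1
      rw [← skeletonLift_apply_of_eq hv y, ← hlift]
      refine hzero v (by_contra fun hvN => ?_)
      exact ha _ (Subtype.ext (hv.symm.trans (contractMap_of_notMem hvN)))

end Skeleton

section FlatNullVectors

variable {V : Type*} [Finite V] {G : SimpleGraph V} {lam : ℝ} {N : Set V}

/-- `g` is the pullback of a vector on the contraction of the components of `G` minus `N` that is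
zero on `N` and whose entries at the neighbours of each vertex of `N` add up to zero. -/
structure IsFlatNull (G : SimpleGraph V) (N : Set V) (g : V → ℝ) : Prop where
  eq_zero : ∀ v ∈ N, g v = 0
  eq_of_adj : ∀ a ∉ N, ∀ b ∉ N, G.Adj a b → g a = g b
  adjOp_eq_zero : ∀ v ∈ N, adjOp G g v = 0

theorem IsFlattening.adjOp_mul_apply {z θ : V → ℝ} (hθ : IsFlattening G N z θ) {v : V} (hv : v ∈ N)
    (b : V → ℝ) : adjOp G (θ * b) v = θ v * adjOp G b v :=
  adjOp_apply_eq_mul fun u hvu => congrArg (· * b u) (hθ.eq_of_adj v hv u hvu)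

theorem isFlatNull_mul (hG : G.IsAcyclic) {z θ b : V → ℝ} (hz : IsGeneric G lam z)
    (hθ : IsFlattening G (zeroSet G lam) z θ) (hb : b ∈ (adjOp G).eigenspace lam) :
    IsFlatNull G (zeroSet G lam) (θ * b) where
  eq_zero v hv := by rw [Pi.mul_apply, eq_zero_of_mem_zeroSet hb hv, mul_zero]
  eq_of_adj u hu v hv huv := by
    refine mul_right_cancel₀ (mul_ne_zero (hz.ne_zero u hu) (hz.ne_zero v hv)) ?_
    have hbz : b u * z v = b v * z u := mul_eq_mul_of_adj hG hb hz.mem_eigenspace huv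
    have hθz : θ u * z u = θ v * z v := hθ.mul_eq_mul_of_adj u hu v hv huv
    simp only [Pi.mul_apply]
    linear_combination b v * z u * hθz + θ u * z u * hbz
  adjOp_eq_zero v hv := by
    rw [hθ.adjOp_mul_apply hv, adjOp_apply_of_mem_eigenspace hb, eq_zero_of_mem_zeroSet hb hv,
      mul_zero, mul_zero]

theorem mem_eigenspace_of_isFlatNull_mul {z θ b : V → ℝ} (hz : IsGeneric G lam z)
    (hθ : IsFlattening G (zeroSet G lam) z θ) (hθb : IsFlatNull G (zeroSet G lam) (θ * b)) :
    b ∈ (adjOp G).eigenspace lam := by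
  have b_eq_zero (v : V) (hv : v ∈ zeroSet G lam) : b v = 0 :=
    (mul_eq_zero.1 (hθb.eq_zero v hv)).resolve_left (hθ.ne_zero v)
  refine Module.End.mem_eigenspace_iff.2 (funext fun v => ?_)
  rw [Pi.smul_apply, smul_eq_mul]
  by_cases hv : v ∈ zeroSet G lam
  · have h := hθb.adjOp_eq_zero v hv
    rw [hθ.adjOp_mul_apply hv] at h
    rw [b_eq_zero v hv, mul_zero, (mul_eq_zero.1 h).resolve_left (hθ.ne_zero v)]
  · have b_eq_mul (u : V) (hvu : G.Adj v u) : b u = b v / z v * z u := by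
      by_cases hu : u ∈ zeroSet G lam
      · rw [b_eq_zero u hu, eq_zero_of_mem_zeroSet hz.mem_eigenspace hu, mul_zero]
      · have hθz : θ v * z v = θ u * z u := hθ.mul_eq_mul_of_adj v hv u hu hvu
        have hθb' : θ v * b v = θ u * b u := hθb.eq_of_adj v hv u hu hvu
        rw [div_mul_eq_mul_div, eq_div_iff (hz.ne_zero v hv)]
        refine mul_left_cancel₀ (hθ.ne_zero v) (mul_left_cancel₀ (hθ.ne_zero u) ?_)
        linear_combination θ u * b u * hθz - θ u * z u * hθb'
    rw [adjOp_apply_eq_mul b_eq_mul, adjOp_apply_of_mem_eigenspace hz.mem_eigenspace,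
      mul_left_comm, div_mul_cancel₀ _ (hz.ne_zero v hv)]

theorem IsFlatNull.exists_skeletonLift_eq {g : V → ℝ} (hg : IsFlatNull G (zeroSet G lam) g) :
    ∃ y, skeletonLift G lam y = g := by
  choose rep hrep using contractMap_surjective G (zeroSet G lam)
  refine ⟨fun a => g (rep a.1), funext fun v => ?_⟩
  by_cases hv : contractMap G (zeroSet G lam) v ∈ skeletonVerts G lam
  · rw [skeletonLift_apply_of_eq (a := ⟨_, hv⟩) rfl]
    exact eq_of_contractMap_eq hg.eq_of_adj (hrep _)
  · rw [skeletonLift_apply_of_notMem hv]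
    exact (hg.eq_zero v (by_contra fun h => hv (contractMap_mem_skeletonVerts_of_notMem h))).symm

theorem mem_eigenspace_zero_of_isFlatNull (hG : G.IsAcyclic) {y : ↥(skeletonVerts G lam) → ℝ}
    (hy : IsFlatNull G (zeroSet G lam) (skeletonLift G lam y)) :
    y ∈ (adjOp (skeleton G lam)).eigenspace 0 := by
  refine Module.End.mem_eigenspace_iff.2 (funext fun a => ?_)
  rw [zero_smul, Pi.zero_apply]
  obtain ⟨v, hv⟩ := contractMap_surjective G _ a.1
  by_cases hvN : v ∈ zeroSet G lam
  · rw [adjOp_skeleton_apply hG hvN hv]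
    exact hy.adjOp_eq_zero v hvN
  · rw [adjOp_apply]
    refine finsum_mem_eq_zero_of_forall_eq_zero fun b hab => ?_
    obtain ⟨u, hu⟩ := contractMap_surjective G _ b.1
    rw [← skeletonLift_apply_of_eq hu y]
    refine hy.eq_zero u (mem_of_contraction_adj (G := G) hvN ?_)
    rw [hv, hu]
    exact hab

theorem skeletonLift_eq_zero_of_mem_zeroSet (hG : G.IsAcyclic) {y : ↥(skeletonVerts G lam) → ℝ}
    (hy : y ∈ (adjOp (skeleton G lam)).eigenspace 0) {v : V} (hv : v ∈ zeroSet G lam) :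
    skeletonLift G lam y v = 0 := by
  by_cases hmem : contractMap G (zeroSet G lam) v ∈ skeletonVerts G lam
  swap
  · exact skeletonLift_apply_of_notMem hmem y
  let a : ↥(skeletonVerts G lam) := ⟨_, hmem⟩
  suffices ha : a ∈ zeroBdry (skeleton G lam) 0 by
    rw [skeletonLift_apply_of_eq (a := a) rfl]
    exact eq_zero_of_mem_zeroSet hy (zeroBdry_subset_zeroSet (isAcyclic_skeleton hG) ha)
  obtain ⟨u, hvu, hu⟩ :=
    exists_adj_notMem_zeroSet ((contractMap_mem_skeletonVerts_iff_of_mem hv).1 hmem)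
  let c : ↥(skeletonVerts G lam) := ⟨_, contractMap_mem_skeletonVerts_of_notMem hu⟩
  -- `θ * z` descends to a null vector of the skeleton without zeros at the contracted components.
  obtain ⟨z, hz⟩ := exists_isGeneric G lam
  obtain ⟨θ, hθ⟩ := exists_isFlattening hG hz.ne_zero
  have hflat := isFlatNull_mul hG hz hθ hz.mem_eigenspace
  obtain ⟨y₀, hy₀⟩ := hflat.exists_skeletonLift_eq
  have ha : y₀ a = 0 := by
    rw [← skeletonLift_apply_of_eq (a := a) rfl y₀, hy₀]
    exact hflat.eq_zero v hv
  have hc : y₀ c ≠ 0 := by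
    rw [← skeletonLift_apply_of_eq (a := c) rfl y₀, hy₀]
    exact mul_ne_zero (hθ.ne_zero u) (hz.ne_zero u hu)
  have hac : (skeleton G lam).Adj a c := (map_adj' ..).2
    ⟨fun h => ((contractMap_eq_iff_of_adj hvu).1 h).1 hv, v, u, hvu, rfl, rfl⟩
  have hy₀_null : y₀ ∈ (adjOp (skeleton G lam)).eigenspace 0 :=
    mem_eigenspace_zero_of_isFlatNull hG (hy₀ ▸ hflat)
  exact ⟨y₀, ⟨hy₀_null, fun h => hc (congrFun h c)⟩, ha, c, hac, hc⟩

theorem isFlatNull_skeletonLift (hG : G.IsAcyclic) {y : ↥(skeletonVerts G lam) → ℝ}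
    (hy : y ∈ (adjOp (skeleton G lam)).eigenspace 0) :
    IsFlatNull G (zeroSet G lam) (skeletonLift G lam y) where
  eq_zero v hv := skeletonLift_eq_zero_of_mem_zeroSet hG hy hv
  eq_of_adj u hu v hv huv := by
    simp only [skeletonLift, LinearMap.comp_apply, LinearMap.funLeft_apply,
      (contractMap_eq_iff_of_adj huv).2 ⟨hu, hv⟩]
  adjOp_eq_zero v hv := by
    by_cases hmem : contractMap G (zeroSet G lam) v ∈ skeletonVerts G lam
    · rw [← adjOp_skeleton_apply hG hv (a := ⟨_, hmem⟩) rfl, adjOp_apply_of_mem_eigenspace hy,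
        zero_mul]
    · rw [adjOp_apply]
      refine finsum_mem_eq_zero_of_forall_eq_zero fun u hvu =>
        skeletonLift_eq_zero_of_mem_zeroSet hG hy (by_contra fun hu => hmem ?_)
      exact (contractMap_mem_skeletonVerts_iff_of_mem hv).2 (mem_zeroBdry_of_adj hv hu hvu)

theorem exists_linearEquiv_samePattern (hG : G.IsAcyclic) :
    ∃ Φ : (adjOp G).eigenspace lam ≃ₗ[ℝ] (adjOp (skeleton G lam)).eigenspace 0,
      ∀ b : (adjOp G).eigenspace lam, SamePattern G lam b (Φ b) := by
  obtain ⟨z, hz⟩ := exists_isGeneric G lam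
  obtain ⟨θ, hθ⟩ := exists_isFlattening hG hz.ne_zero
  have mul_θ_injective : Function.Injective (LinearMap.mulLeft ℝ θ) := fun b b' h =>
    funext fun v => mul_left_cancel₀ (hθ.ne_zero v) (congrFun h v)
  have map_eq : ((adjOp G).eigenspace lam).map (LinearMap.mulLeft ℝ θ) =
      ((adjOp (skeleton G lam)).eigenspace 0).map (skeletonLift G lam) := by
    ext g
    constructor
    · rintro ⟨b, hb, rfl⟩
      have hflat := isFlatNull_mul hG hz hθ hb
      obtain ⟨y, hy⟩ := hflat.exists_skeletonLift_eq
      exact ⟨y, mem_eigenspace_zero_of_isFlatNull hG (hy ▸ hflat), hy⟩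
    · rintro ⟨y, hy, rfl⟩
      have θ_mul_div : θ * (skeletonLift G lam y / θ) = skeletonLift G lam y :=
        funext fun v => mul_div_cancel₀ _ (hθ.ne_zero v)
      refine ⟨_, mem_eigenspace_of_isFlatNull_mul hz hθ ?_, θ_mul_div⟩
      rw [θ_mul_div]
      exact isFlatNull_skeletonLift hG hy
  obtain ⟨Φ, hΦ⟩ := exists_linearEquiv_of_map_eq mul_θ_injective (skeletonLift_injective G lam)
    map_eq
  refine ⟨Φ, fun b => samePattern_iff.2 ⟨fun v => eq_zero_of_mem_zeroSet b.2, fun v => ?_⟩⟩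
  rw [hΦ b, LinearMap.mulLeft_apply, Pi.mul_apply, mul_eq_zero, or_iff_right (hθ.ne_zero v)]

end FlatNullVectors

section StraightSets

variable {V W : Type*} [Finite V] {G : SimpleGraph V} {lam : ℝ}

theorem IsStraight.linearIndependent_of_eq_zero_iff {r : ℕ} {x : Fin r → V → ℝ}
    (hx : IsStraight G lam x) {y : Fin r → W → ℝ} (e : V → W)
    (hxy : ∀ j v, x j v = 0 ↔ y j (e v) = 0) : LinearIndependent ℝ y := by
  obtain ⟨-, C, hC⟩ := hx
  choose w hw hne using fun j => (hC j).1
  exact linearIndependent_of_triangular (e ∘ w) (fun j => (hxy j _).not.1 (hne j))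
    fun j i hji => (hxy j _).1 ((hC j).2 i hji _ (hw i))

theorem IsStraight.linearIndependent_of_samePattern {r : ℕ} {b : Fin r → V → ℝ}
    {b' : Fin r → ↥(skeletonVerts G lam) → ℝ} (hb : IsStraight G lam b)
    (hbb' : ∀ j, SamePattern G lam (b j) (b' j)) : LinearIndependent ℝ b' :=
  .of_comp (skeletonLift G lam) <| hb.linearIndependent_of_eq_zero_iff id fun j =>
    (samePattern_iff.1 (hbb' j)).2

theorem linearIndependent_of_samePattern_of_isStraight_skeleton {r : ℕ} {b : Fin r → V → ℝ}
    {b' : Fin r → ↥(skeletonVerts G lam) → ℝ} (hb' : IsStraight (skeleton G lam) 0 b')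
    (hbb' : ∀ j, SamePattern G lam (b j) (b' j)) : LinearIndependent ℝ b := by
  choose rep hrep using contractMap_surjective G (zeroSet G lam)
  refine hb'.linearIndependent_of_eq_zero_iff (fun a => rep a.1) fun j a => ?_
  rw [(samePattern_iff.1 (hbb' j)).2, skeletonLift_apply_of_eq (hrep a.1)]

end StraightSets

end TreeSkeleton

open TreeSkeleton in
theorem mainTheorem2_general {V : Type*} [Finite V] (T : SimpleGraph V) (hT : T.IsAcyclic)
    (lam : ℝ) :
    (∀ b, IsEigvec T lam b →
      ∃ b', IsEigvec (skeleton T lam) 0 b' ∧ SamePattern T lam b b') ∧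
    (∀ (r : ℕ) (b : Fin r → V → ℝ) (b' : Fin r → ↥(skeletonVerts T lam) → ℝ),
      IsStraight T lam b → (∀ j, SamePattern T lam (b j) (b' j)) →
        LinearIndependent ℝ b') ∧
    (∀ b', IsEigvec (skeleton T lam) 0 b' →
      ∃ b, IsEigvec T lam b ∧ SamePattern T lam b b') ∧
    (∀ (r : ℕ) (b' : Fin r → ↥(skeletonVerts T lam) → ℝ) (b : Fin r → V → ℝ),
      IsStraight (skeleton T lam) 0 b' → (∀ j, SamePattern T lam (b j) (b' j)) →
        LinearIndependent ℝ b) ∧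
    multiplicity T lam = nullity (skeleton T lam) := by
  obtain ⟨Φ, hΦ⟩ := exists_linearEquiv_samePattern (lam := lam) hT
  refine ⟨fun b hb => ?_, fun r b b' hb => hb.linearIndependent_of_samePattern, fun b' hb' => ?_,
    fun r b' b hb' => linearIndependent_of_samePattern_of_isStraight_skeleton hb', ?_⟩
  · refine ⟨Φ ⟨b, hb.1⟩, ⟨(Φ _).2, ?_⟩, hΦ ⟨b, hb.1⟩⟩
    simpa using hb.2
  · refine ⟨Φ.symm ⟨b', hb'.1⟩, ⟨(Φ.symm _).2, ?_⟩, ?_⟩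
    · simpa using hb'.2
    · simpa using hΦ (Φ.symm ⟨b', hb'.1⟩)
  · rw [nullity_eq_multiplicity_zero]
    exact Φ.finrank_eq

theorem mainTheorem2 {V : Type*} [Finite V] (T : SimpleGraph V) (hT : T.IsTree) (lam : ℝ)
    (hlam : (TreeSkeleton.adjOp T).HasEigenvalue lam) :
    -- every eigenvector of the tree has a matching null vector of the skeleton
    (∀ b : V → ℝ, TreeSkeleton.IsEigvec T lam b →
      ∃ b' : ↥(TreeSkeleton.skeletonVerts T lam) → ℝ,
        TreeSkeleton.IsEigvec (TreeSkeleton.skeleton T lam) 0 b' ∧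
          TreeSkeleton.SamePattern T lam b b') ∧
    -- null vectors of the skeleton matching a straight set are linearly independent
    (∀ (r : ℕ) (b : Fin r → V → ℝ) (b' : Fin r → ↥(TreeSkeleton.skeletonVerts T lam) → ℝ),
      TreeSkeleton.IsStraight T lam b →
      (∀ j, TreeSkeleton.IsEigvec (TreeSkeleton.skeleton T lam) 0 (b' j)) →
      (∀ j, TreeSkeleton.SamePattern T lam (b j) (b' j)) → LinearIndependent ℝ b') ∧
    -- every non-zero null vector of the skeleton has a matching eigenvector of the tree
    (∀ b' : ↥(TreeSkeleton.skeletonVerts T lam) → ℝ,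
      TreeSkeleton.IsEigvec (TreeSkeleton.skeleton T lam) 0 b' →
      ∃ b : V → ℝ, TreeSkeleton.IsEigvec T lam b ∧ TreeSkeleton.SamePattern T lam b b') ∧
    -- eigenvectors of the tree matching a straight set of null vectors are linearly independent
    (∀ (r : ℕ) (b' : Fin r → ↥(TreeSkeleton.skeletonVerts T lam) → ℝ) (b : Fin r → V → ℝ),
      TreeSkeleton.IsStraight (TreeSkeleton.skeleton T lam) 0 b' →
      (∀ j, TreeSkeleton.IsEigvec T lam (b j)) →
      (∀ j, TreeSkeleton.SamePattern T lam (b j) (b' j)) → LinearIndependent ℝ b) ∧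
    -- the multiplicity equals the nullity of the skeleton
    TreeSkeleton.multiplicity T lam = TreeSkeleton.nullity (TreeSkeleton.skeleton T lam) := by
  obtain ⟨h₁, h₂, h₃, h₄, h₅⟩ := mainTheorem2_general T hT.isAcyclic lam
  exact ⟨h₁, fun r b b' hb _ => h₂ r b b' hb, h₃, fun r b' b hb' _ => h₄ r b' b hb', h₅⟩
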